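/- For a group $G$, a family of subgroups of $G$ is a non-empty set of subgroups closed under conjugation and finite intersections; it is subgroup-closed if it contains every subgroup of each of its members. For a family $\mathfrak F$ of subgroups of $G$, the orbit category $\mathcal O_{\mathfrak F}G$ has as objects the $G$-sets $G/H$ with $H\in\mathfrak F$ and as morphisms all $G$-maps, and a right $\mathcal O_{\mathfrak F}G$-module is a contravariant functor from $\mathcal O_{\mathfrak F}G$ to abelian groups. The Bredon cohomological dimension $\operatorname{cd}_{\mathfrak F}G\in\{0,1,2,\dots\}\cup\{\infty\}$ is the projective dimension, in the abelian category of right $\mathcal O_{\mathfrak F}G$-modules, of the trivial module $\underline{\mathbb Z}_{\mathfrak F}$ (the constant functor with value $\mathbb Z$). For $K\le G$ put $\mathfrak F\cap K=\{H\cap K \mid H\in\mathfrak F\}$, a family of subgroups of $K$. **Proposition.** Let $G_1$ and $G_2$ be groups and let $\mathfrak F_1$ and $\mathfrak F_2$ be subgroup-closed families of subgroups of $G_1$ and $G_2$ respectively. Let $G=G_1\times G_2$, let $\mathfrak F=\mathfrak F_1\times\mathfrak F_2=\{H_1\times H_2 \mid H_1\in\mathfrak F_1,\ H_2\in\mathfrak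 F_2\}$, and let $\bar{\mathfrak F}=\{H\le G \mid H\le K\text{ for some }K\in\mathfrak F\}$ be its subgroup completion. Let $\mathfrak G\subset\bar{\mathfrak F}$ be a subgroup-closed family of subgroups of $G$. Assume that there exists $k\in\mathbb N$ (where $0\in\mathbb N$) such that $\operatorname{cd}_{\mathfrak G\cap K}K\le k$ for every $K\in\mathfrak F$. Then $$\operatorname{cd}_{\mathfrak G}G\le \operatorname{cd}_{\mathfrak F_1}G_1+\operatorname{cd}_{\mathfrak F_2}G_2+k .$$ -/

import Mathlib

open CategoryTheory
open scoped Pointwise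

universe u

namespace Bredon

/-- A family of subgroups of `G`: a non-empty set of subgroups closed under conjugation and
finite intersections. -/
structure IsFamily {G : Type u} [Group G] (F : Set (Subgroup G)) : Prop where
  nonempty : F.Nonempty
  conj_mem : ∀ (g : G), ∀ H ∈ F, MulAut.conj g • H ∈ F
  inf_mem : ∀ H ∈ F, ∀ K ∈ F, H ⊓ K ∈ F

/-- A family of subgroups that is closed under passing to subgroups. -/
structure IsSubgroupClosedFamily {G : Type u} [Group G] (F : Set (Subgroup G)) : Prop
    extends IsFamily F where
  mem_of_le : ∀ H ∈ F, ∀ L : Subgroup G, L ≤ H → L ∈ F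

/-- `F ∩ K = {H ∩ K | H ∈ F}`, as a set of subgroups of the group `K`. -/
def restrictFamily {G : Type u} [Group G] (F : Set (Subgroup G)) (K : Subgroup G) :
    Set (Subgroup K) :=
  {L | ∃ H ∈ F, L = H.subgroupOf K}

/-- `F₁ × F₂ = {H₁ × H₂ | H₁ ∈ F₁, H₂ ∈ F₂}`. -/
def prodFamily {G₁ G₂ : Type u} [Group G₁] [Group G₂]
    (F₁ : Set (Subgroup G₁)) (F₂ : Set (Subgroup G₂)) : Set (Subgroup (G₁ × G₂)) :=
  {K | ∃ H₁ ∈ F₁, ∃ H₂ ∈ F₂, K = H₁.prod H₂}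

/-- The subgroup completion `{H | H ≤ K for some K ∈ F}` of `F`. -/
def subgroupCompletion {G : Type u} [Group G] (F : Set (Subgroup G)) : Set (Subgroup G) :=
  {H | ∃ K ∈ F, H ≤ K}

/-- Objects of the orbit category: the transitive `G`-sets `G ⧸ H` with `H ∈ F`, each recorded
by its subgroup `H`. -/
structure OrbitCat {G : Type u} [Group G] (F : Set (Subgroup G)) : Type u where
  subgroup : Subgroup G
  mem : subgroup ∈ F

/-- Morphisms of the orbit category are all `G`-maps `G ⧸ H → G ⧸ K`. -/
instance {G : Type u} [Group G] (F : Set (Subgroup G)) : Category.{u} (OrbitCat F) where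
  Hom X Y := (G ⧸ X.subgroup) →[G] (G ⧸ Y.subgroup)
  id X := MulActionHom.id G
  comp f g := g.comp f

/-- Right Bredon modules: contravariant functors from the orbit category to abelian groups
(regarded as `ℤ`-modules), with natural transformations as morphisms. -/
abbrev RightModule {G : Type u} [Group G] (F : Set (Subgroup G)) : Type (u + 1) :=
  (OrbitCat F)ᵒᵖ ⥤ ModuleCat.{u} ℤ

/-- The trivial module: the constant functor with value `ℤ` (lifted to the universe of `G`). -/
def trivialModule {G : Type u} [Group G] (F : Set (Subgroup G)) : RightModule F :=
  (Functor.const (OrbitCat F)ᵒᵖ).obj (ModuleCat.of ℤ (ULift.{u} ℤ))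

/-- The Bredon cohomological dimension of `G` with respect to `F`: the projective dimension of
the trivial module in the abelian category of right Bredon modules. The value `⊤` means infinite
dimension; `⊥`, the projective dimension of a zero object, does not occur for non-empty `F`. -/
noncomputable def cd {G : Type u} [Group G] (F : Set (Subgroup G)) : WithBot ℕ∞ :=
  projectiveDimension (trivialModule F)

end Bredon

/-! The engine is a dimension count: if an exact, coproduct-preserving functor `S` between module
categories sends every free module of rank one to a module of projective dimension at most `m`, then
`S` raises projective dimension by at most `m` (`hasProjectiveDimensionLT_map_of_free`). It is
applied three times, with ℤ[T] denoting the free module on the functor L ↦ Map_G(G/L, T).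

Restriction along G/L ↦ G₁/pr₁(L) preserves the trivial module, so cd 𝔊 is at most cd 𝔉₁ plus a
bound for the restrictions of the free modules ℤ[G₁/H₁]. Such a restriction is free on a set-valued
functor X. Pulling back along pr₂ to the category of elements of X and summing over the fibres of X
is exact, takes the trivial module over 𝔉₂ to that restriction, and takes ℤ[G₂/H₂] to ℤ[G₁/H₁ ×
G₂/H₂]. This costs cd 𝔉₂.

Finally T = G₁/H₁ × G₂/H₂ is a transitive G-set with stabilizer K = H₁ × H₂. Taking fibres over the
base point turns orbits over T into orbits of K. The same summation takes the trivial module of K to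
ℤ[T] and ℤ[K/J] to the projective ℤ[G/J], so ℤ[T] has projective dimension at most cd K ≤ k. The key
lemmas are `hasProjectiveDimensionLT_freeOn_of_elements`, `extendNatTrans_bijective` and
`pairHom_bijective`. -/

namespace Bredon
open Limits

/-! ### Projective dimension under exact functors and coproducts -/

section Homological

universe w v₁ u₁ v₂ u₂

variable {A : Type u₁} [Category.{v₁} A] [Abelian A]

omit [Abelian A] in
lemma projective_sigma {ι : Type w} (X : ι → A) [HasCoproduct X] (hX : ∀ i, Projective (X i)) :
    Projective (∐ X) where
  factors f e _ :=
    ⟨Sigma.desc fun i => (hX i).factors (Sigma.ι X i ≫ f) e |>.choose, by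
      refine Sigma.hom_ext _ _ fun i => ?_
      rw [Sigma.ι_desc_assoc]
      exact ((hX i).factors (Sigma.ι X i ≫ f) e).choose_spec⟩

/-- An exact functor taking projectives to objects of projective dimension `< m + 1` raises the
projective dimension by at most `m`. -/
lemma hasProjectiveDimensionLT_map_of_projective {B : Type u₂} [Category.{v₂} B] [Abelian B]
    [EnoughProjectives A] (S : A ⥤ B) [S.PreservesZeroMorphisms] [PreservesFiniteLimits S]
    [PreservesFiniteColimits S]
    (m : ℕ) (hS : ∀ P : A, Projective P → HasProjectiveDimensionLT (S.obj P) (m + 1))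
    (n : ℕ) (M : A) (hM : HasProjectiveDimensionLT M (n + 1)) :
    HasProjectiveDimensionLT (S.obj M) (n + m + 1) := by
  -- Dimension shifting; `HasProjectiveDimensionLT M (n + 1)` encodes pd M ≤ n, so the base case is
  -- M projective.
  induction n generalizing M with
  | zero =>
    rw [zero_add] at *
    exact hS M ((projective_iff_hasProjectiveDimensionLT_one).2 hM)
  | succ n ih =>
    let T : ShortComplex A := ShortComplex.mk (kernel.ι (Projective.π M)) (Projective.π M) (by simp)
    have hT : T.ShortExact :=
      { exact := ShortComplex.exact_of_f_is_kernel _ (kernelIsKernel (Projective.π M)) }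
    have h₁ : HasProjectiveDimensionLT T.X₁ (n + 1) :=
      (hT.hasProjectiveDimensionLT_X₃_iff n
        (inferInstanceAs (Projective (Projective.over M)))).1 hM
    have h₂ := hS (Projective.over M) inferInstance
    have := (hT.map_of_exact S).hasProjectiveDimensionLT_X₃ (n + m + 1) (ih _ h₁)
      (hasProjectiveDimensionLT_of_ge (S.obj (Projective.over M)) (m + 1) _ (by lia))
    rwa [show n + 1 + m + 1 = n + m + 1 + 1 by lia]

/-- Coproducts do not raise the projective dimension. -/
lemma hasProjectiveDimensionLT_sigma [EnoughProjectives A] {ι : Type w}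
    [HasColimitsOfShape (Discrete ι) A] [HasExactColimitsOfShape (Discrete ι) A]
    (m : ℕ) (X : ι → A) (hX : ∀ i, HasProjectiveDimensionLT (X i) (m + 1)) :
    HasProjectiveDimensionLT (∐ X) (m + 1) := by
  induction m generalizing X with
  | zero =>
    exact (projective_iff_hasProjectiveDimensionLT_one).1 (projective_sigma X fun i =>
      (projective_iff_hasProjectiveDimensionLT_one).2 (hX i))
  | succ m ih =>
    -- The sequences of syzygies are assembled into one sequence of families, so that exactness of
    -- `colim` makes their coproduct short exact.
    let T : ShortComplex (Discrete ι ⥤ A) := ShortComplex.mk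
      (Discrete.natTrans fun i => kernel.ι (Projective.π (X i.as)) :
        Discrete.functor (fun i => kernel (Projective.π (X i))) ⟶
          Discrete.functor (fun i => Projective.over (X i)))
      (Discrete.natTrans fun i => Projective.π (X i.as) : _ ⟶ Discrete.functor X)
      (by ext; simp)
    have hf : Mono T.f := by
      have : ∀ j, Mono (T.f.app j) := fun j =>
        inferInstanceAs (Mono (kernel.ι (Projective.π (X j.as))))
      exact NatTrans.mono_of_mono_app _
    have hg : Epi T.g := by
      have : ∀ j, Epi (T.g.app j) := fun j =>
        inferInstanceAs (Epi (Projective.π (X j.as)))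
      exact NatTrans.epi_of_epi_app _
    have hT : T.ShortExact :=
      { exact := by
          refine (ShortComplex.exact_and_mono_f_iff_f_is_kernel T).2 ?_ |>.1
          refine ⟨evaluationJointlyReflectsLimits _ fun j => ?_⟩
          refine (isLimitMapConeForkEquiv' ((evaluation _ _).obj j) T.zero).symm ?_
          exact kernelIsKernel (Projective.π (X j.as)) }
    have h₂ : Projective (colim.obj T.X₂) :=
      projective_sigma _ fun i => Projective.projective_over (X i)
    have hker : ∀ i, HasProjectiveDimensionLT (kernel (Projective.π (X i))) (m + 1) := fun i => by
      let U : ShortComplex A :=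
        ShortComplex.mk (kernel.ι (Projective.π (X i))) (Projective.π (X i)) (by simp)
      have hU : U.ShortExact :=
        { exact := ShortComplex.exact_of_f_is_kernel _ (kernelIsKernel (Projective.π (X i))) }
      exact (hU.hasProjectiveDimensionLT_X₃_iff m
        (inferInstanceAs (Projective (Projective.over (X i))))).1 (hX i)
    exact ((hT.map_of_exact colim).hasProjectiveDimensionLT_X₃_iff m h₂).2 (ih _ hker)

/-- An exact functor preserving coproducts raises the projective dimension by at most the
supremum of the projective dimensions of the images of projective generators. -/
lemma hasProjectiveDimensionLT_map {B : Type u₂} [Category.{v₂} B] [Abelian B]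
    [EnoughProjectives B] [HasCoproducts.{w} A] [HasCoproducts.{w} B] [AB4OfSize.{w} B]
    (S : A ⥤ B) [S.PreservesZeroMorphisms] [PreservesFiniteLimits S]
    [PreservesFiniteColimits S] [∀ J : Type w, PreservesColimitsOfShape (Discrete J) S]
    {ι : Type*} (G : ι → A) (hGp : ∀ i, Projective (G i))
    (hG : ∀ M : A, ∃ (J : Type w) (f : J → ι) (p : ∐ (fun j => G (f j)) ⟶ M), Epi p)
    (m : ℕ) (hS : ∀ i, HasProjectiveDimensionLT (S.obj (G i)) (m + 1))
    (n : ℕ) (M : A) (hM : HasProjectiveDimensionLT M (n + 1)) :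
    HasProjectiveDimensionLT (S.obj M) (n + m + 1) := by
  have : EnoughProjectives A := ⟨fun M => by
    obtain ⟨J, f, p, hp⟩ := hG M
    exact ⟨{ p := _, projective := projective_sigma _ fun j => hGp (f j), f := p }⟩⟩
  refine hasProjectiveDimensionLT_map_of_projective S m (fun P hP => ?_) n M hM
  obtain ⟨J, f, p, hp⟩ := hG P
  -- A projective is a retract of a coproduct of generators, and functors preserve retracts.
  let r : Retract P (∐ fun j => G (f j)) :=
    { i := Projective.factorThru (𝟙 P) p, r := p }
  have := hasProjectiveDimensionLT_sigma m (fun j => S.obj (G (f j))) (fun j => hS _)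
  have := hasProjectiveDimensionLT_of_iso (PreservesCoproduct.iso S fun j => G (f j)).symm (m + 1)
  exact (r.map S).hasProjectiveDimensionLT _

end Homological

end Bredon

namespace Bredon
open Limits

/-! ### Free functors and summation over the fibres of a set-valued functor -/

section FunctorCategory

universe u₁

variable {C : Type u} [SmallCategory C] {𝒜 : Type u₁} [Category.{u} 𝒜] [HasCoproducts.{u} 𝒜]

/-- Morphisms out of the free functor on a corepresentable functor. -/
noncomputable def homFreeEquiv (A : 𝒜) (d : C) (M : C ⥤ 𝒜) :
    (coyoneda.obj (Opposite.op d) ⋙ sigmaConst.obj A ⟶ M) ≃ (A ⟶ M.obj d) where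
  toFun f := Sigma.ι (fun _ : d ⟶ d => A) (𝟙 d) ≫ f.app d
  invFun x :=
    { app c := Sigma.desc fun φ : d ⟶ c => x ≫ M.map φ
      naturality c c' g := Sigma.hom_ext _ _ fun φ => by simp }
  left_inv f := by
    ext c
    refine Sigma.hom_ext _ _ fun (φ : d ⟶ c) => ?_
    simpa using (Sigma.ι (fun _ : d ⟶ d => A) (𝟙 d) ≫= f.naturality φ).symm
  right_inv x := by simp

lemma homFreeEquiv_comp (A : 𝒜) (d : C) {M N : C ⥤ 𝒜}
    (f : coyoneda.obj (Opposite.op d) ⋙ sigmaConst.obj A ⟶ M) (g : M ⟶ N) :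
    homFreeEquiv A d N (f ≫ g) = homFreeEquiv A d M f ≫ g.app d := by
  simp [homFreeEquiv]

lemma homFreeEquiv_symm_comp (A : 𝒜) (d : C) {M N : C ⥤ 𝒜} (x : A ⟶ M.obj d) (g : M ⟶ N) :
    (homFreeEquiv A d M).symm x ≫ g = (homFreeEquiv A d N).symm (x ≫ g.app d) := by
  apply (homFreeEquiv A d N).injective
  simp [homFreeEquiv_comp]

/-- By the Yoneda-type bijection `homFreeEquiv`, lifting against an epimorphism reduces to lifting
out of `A` against its component at `d`. -/
lemma projective_free [HasPushouts 𝒜] (A : 𝒜) [Projective A] (d : C) :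
    Projective (coyoneda.obj (Opposite.op d) ⋙ sigmaConst.obj A : C ⥤ 𝒜) where
  factors {E X} f e _ :=
    ⟨(homFreeEquiv A d E).symm (Projective.factorThru (homFreeEquiv A d X f) (e.app d)), by
      rw [homFreeEquiv_symm_comp, Projective.factorThru_comp, Equiv.symm_apply_apply]⟩

lemma exists_epi_of_isSeparator (A : 𝒜) (hA : IsSeparator A) (M : C ⥤ 𝒜) :
    ∃ (J : Type u) (f : J → C) (p : ∐ (fun j => coyoneda.obj (Opposite.op (f j)) ⋙
      sigmaConst.obj A) ⟶ M), Epi p := by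
  -- One summand for each `A`-valued point of each `M.obj d`; the separator then detects equality
  -- objectwise.
  refine ⟨Σ d, A ⟶ M.obj d, Sigma.fst, Sigma.desc fun j => (homFreeEquiv A j.1 M).symm j.2,
    ⟨fun {N} f g h => ?_⟩⟩
  ext d : 2
  refine hA.def _ _ fun x => ?_
  have := Sigma.ι (fun j : Σ d, A ⟶ M.obj d => coyoneda.obj (Opposite.op j.1) ⋙
      sigmaConst.obj A) ⟨d, x⟩ ≫= h
  simp only [Sigma.ι_desc_assoc, homFreeEquiv_symm_comp] at this
  exact (homFreeEquiv A d N).symm.injective this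

variable (X : C ⥤ Type u)

/-- Allows the summand index to be replaced by a propositionally equal one, as the functor laws of
the sum require. -/
lemma map_homMk_ι (M : X.Elements ⥤ 𝒜) {c c' : C} (f : c ⟶ c') {x : X.obj c} {x' : X.obj c'}
    (h : X.map f x = x') :
    M.map (CategoryOfElements.homMk (X.elementsMk c x) (X.elementsMk c' (X.map f x)) f rfl) ≫
        Limits.Sigma.ι (fun x : X.obj c' => M.obj (X.elementsMk c' x)) (X.map f x) =
      M.map (CategoryOfElements.homMk (X.elementsMk c x) (X.elementsMk c' x') f h) ≫
        Limits.Sigma.ι (fun x : X.obj c' => M.obj (X.elementsMk c' x)) x' := by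
  subst h
  rfl

/-- The value of `sumElements` on objects. -/
noncomputable def sumElementsObj (M : X.Elements ⥤ 𝒜) : C ⥤ 𝒜 where
  obj c := ∐ fun x : X.obj c => M.obj (X.elementsMk c x)
  map {c c'} f := Limits.Sigma.desc fun x =>
    M.map (CategoryOfElements.homMk (X.elementsMk c x) (X.elementsMk c' (X.map f x)) f rfl) ≫
      Limits.Sigma.ι (fun x : X.obj c' => M.obj (X.elementsMk c' x)) (X.map f x)
  map_id c := by
    refine Limits.Sigma.hom_ext _ _ fun x => ?_
    rw [Sigma.ι_desc, map_homMk_ι X M (𝟙 c) (x' := x) (by simp), Category.comp_id]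
    exact (congrArg (· ≫ _) (M.map_id (X.elementsMk c x))).trans (Category.id_comp _)
  map_comp {a b c} f g := by
    refine Limits.Sigma.hom_ext _ _ fun x => ?_
    rw [Sigma.ι_desc, map_homMk_ι X M (f ≫ g) (x' := X.map g (X.map f x)) (by simp),
      Sigma.ι_desc_assoc, Category.assoc, Sigma.ι_desc, ← Category.assoc, ← M.map_comp]
    rfl

variable {X} in
/-- The inclusion of a summand of `sumElementsObj`. -/
noncomputable def sumElementsι (M : X.Elements ⥤ 𝒜) (c : C) (x : X.obj c) :
    M.obj (X.elementsMk c x) ⟶ (sumElementsObj X M).obj c :=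
  Limits.Sigma.ι (fun x : X.obj c => M.obj (X.elementsMk c x)) x

variable {X} in
/-- The morphism out of a value of `sumElementsObj` given by its restrictions to the summands. -/
noncomputable def sumElementsDesc (M : X.Elements ⥤ 𝒜) (c : C) {Z : 𝒜}
    (f : ∀ x : X.obj c, M.obj (X.elementsMk c x) ⟶ Z) : (sumElementsObj X M).obj c ⟶ Z :=
  Limits.Sigma.desc f

lemma sumElementsι_desc (M : X.Elements ⥤ 𝒜) (c : C) {Z : 𝒜}
    (f : ∀ x : X.obj c, M.obj (X.elementsMk c x) ⟶ Z) (x : X.obj c) :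
    sumElementsι M c x ≫ sumElementsDesc M c f = f x :=
  Sigma.ι_desc _ _

lemma sumElementsι_desc_assoc (M : X.Elements ⥤ 𝒜) (c : C) {Z Z' : 𝒜}
    (f : ∀ x : X.obj c, M.obj (X.elementsMk c x) ⟶ Z) (x : X.obj c) (h : Z ⟶ Z') :
    sumElementsι M c x ≫ sumElementsDesc M c f ≫ h = f x ≫ h := by
  rw [← Category.assoc, sumElementsι_desc]

lemma sumElements_hom_ext (M : X.Elements ⥤ 𝒜) {c : C} {Z : 𝒜}
    {f g : (sumElementsObj X M).obj c ⟶ Z}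
    (h : ∀ x, sumElementsι M c x ≫ f = sumElementsι M c x ≫ g) : f = g :=
  Limits.Sigma.hom_ext _ _ h

lemma sumElementsι_map (M : X.Elements ⥤ 𝒜) {c c' : C} (f : c ⟶ c') (x : X.obj c) :
    sumElementsι M c x ≫ (sumElementsObj X M).map f =
      M.map (CategoryOfElements.homMk (X.elementsMk c x) (X.elementsMk c' (X.map f x)) f rfl) ≫
        sumElementsι M c' (X.map f x) :=
  Sigma.ι_desc _ _

lemma sumElementsι_map_assoc (M : X.Elements ⥤ 𝒜) {c c' : C} (f : c ⟶ c') (x : X.obj c)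
    {Z : 𝒜} (h : (sumElementsObj X M).obj c' ⟶ Z) :
    sumElementsι M c x ≫ (sumElementsObj X M).map f ≫ h =
      M.map (CategoryOfElements.homMk (X.elementsMk c x) (X.elementsMk c' (X.map f x)) f rfl) ≫
        sumElementsι M c' (X.map f x) ≫ h := by
  rw [← Category.assoc, sumElementsι_map, Category.assoc]

/-- The left Kan extension along `X.Elements ⥤ C`: summation over the fibres of `X`. -/
noncomputable abbrev sumElements : (X.Elements ⥤ 𝒜) ⥤ (C ⥤ 𝒜) where
  obj M := sumElementsObj X M
  map {M N} φ :=
    { app c := sumElementsDesc M c fun x => φ.app (X.elementsMk c x) ≫ sumElementsι N c x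
      naturality c c' f := sumElements_hom_ext _ _ fun x => by
        rw [sumElementsι_map_assoc, sumElementsι_desc_assoc, sumElementsι_desc, Category.assoc,
          sumElementsι_map, φ.naturality_assoc] }
  map_id M := by
    ext c
    exact sumElements_hom_ext _ _ fun x => by simp [sumElementsι_desc]
  map_comp φ ψ := by
    ext c
    exact sumElements_hom_ext _ _ fun x => by
      simp [sumElementsι_desc, sumElementsι_desc_assoc]

/-- The inclusion of a fibre of `X` into its category of elements. -/
def fibreInclusion (c : C) : Discrete (X.obj c) ⥤ X.Elements :=
  Discrete.functor fun x => X.elementsMk c x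

/-- The value of `sumElements` at an object as a colimit over the fibre. -/
noncomputable def colimitFibreIso (M : X.Elements ⥤ 𝒜) (c : C) :
    colimit (fibreInclusion X c ⋙ M) ≅ (sumElementsObj X M).obj c :=
  HasColimit.isoOfNatIso (Discrete.natIso fun _ => Iso.refl _ :
    fibreInclusion X c ⋙ M ≅ Discrete.functor fun x => M.obj (X.elementsMk c x))

lemma ι_colimitFibreIso_hom (M : X.Elements ⥤ 𝒜) (c : C) (x : X.obj c) :
    colimit.ι (fibreInclusion X c ⋙ M) ⟨x⟩ ≫ (colimitFibreIso X M c).hom =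
      sumElementsι M c x :=
  (HasColimit.isoOfNatIso_ι_hom _ _).trans (Category.id_comp _)

lemma ι_colimitFibreIso_hom_assoc (M : X.Elements ⥤ 𝒜) (c : C) (x : X.obj c) {Z : 𝒜}
    (h : (sumElementsObj X M).obj c ⟶ Z) :
    colimit.ι (fibreInclusion X c ⋙ M) ⟨x⟩ ≫ (colimitFibreIso X M c).hom ≫ h =
      sumElementsι M c x ≫ h :=
  (Category.assoc _ _ _).symm.trans (congrArg (· ≫ h) (ι_colimitFibreIso_hom X M c x))

/-- The value of `sumElements` at an object is a coproduct over the fibre, naturally. -/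
noncomputable def sumElementsEvaluationIso (c : C) :
    (Functor.whiskeringLeft _ _ 𝒜).obj (fibreInclusion X c) ⋙ colim ≅
      sumElements X ⋙ (evaluation C 𝒜).obj c :=
  NatIso.ofComponents (fun M => colimitFibreIso X M c)
    (fun {M N} φ => by
      refine colimit.hom_ext fun ⟨x⟩ => ?_
      dsimp
      rw [ι_colimMap_assoc, ι_colimitFibreIso_hom, ι_colimitFibreIso_hom_assoc]
      exact (sumElementsι_desc X M c
        (fun x => φ.app (X.elementsMk c x) ≫ sumElementsι N c x) x).symm)

instance (K : Type u) [SmallCategory K] [HasColimitsOfShape K 𝒜] :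
    PreservesColimitsOfShape K (sumElements (𝒜 := 𝒜) X) :=
  preservesColimitsOfShape_of_evaluation _ _ fun c =>
    preservesColimitsOfShape_of_natIso (sumElementsEvaluationIso X c)

instance [HasFiniteColimits 𝒜] : PreservesFiniteColimits (sumElements (𝒜 := 𝒜) X) :=
  preservesFiniteColimits_of_evaluation _ fun c =>
    ⟨fun _ _ _ => preservesColimitsOfShape_of_natIso (sumElementsEvaluationIso X c)⟩

/-- Evaluated at an object, the functor is restriction to a fibre followed by a coproduct, and
coproducts are exact under AB4. -/
instance [HasFiniteLimits 𝒜] [AB4 𝒜] : PreservesFiniteLimits (sumElements (𝒜 := 𝒜) X) :=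
  preservesFiniteLimits_of_evaluation _ fun c =>
    ⟨fun _ _ _ => preservesLimitsOfShape_of_natIso (sumElementsEvaluationIso X c)⟩

lemma ι_sigmaConst_map (A : 𝒜) {S T : Type u} (f : S ⟶ T) (s : S) :
    Limits.Sigma.ι (fun _ : S => A) s ≫ (sigmaConst.obj A).map f =
      Limits.Sigma.ι (fun _ : T => A) (f s) := by
  simp

/-- Summation over fibres takes free functors to free functors. -/
lemma nonempty_sumElements_free_iso (A : 𝒜) (Y : X.Elements ⥤ Type u) (W : C ⥤ Type u)
    (α : Y ⟶ CategoryOfElements.π X ⋙ W)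
    (hα : ∀ c, Function.Bijective fun p : (Σ x : X.obj c, Y.obj (X.elementsMk c x)) => α.app (X.elementsMk c p.1) p.2) :
    Nonempty ((sumElements X).obj (Y ⋙ sigmaConst.obj A) ≅ W ⋙ sigmaConst.obj A) := by
  let η : (sumElements X).obj (Y ⋙ sigmaConst.obj A) ⟶ W ⋙ sigmaConst.obj A :=
    { app c := sumElementsDesc _ c fun x => (sigmaConst.obj A).map (α.app (X.elementsMk c x))
      naturality c c' f := sumElements_hom_ext _ _ fun x => by
        erw [sumElementsι_map_assoc, sumElementsι_desc, sumElementsι_desc_assoc]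
        exact ((sigmaConst.obj A).map_comp _ _).symm.trans
          ((congrArg (sigmaConst.obj A).map (α.naturality _)).trans
            ((sigmaConst.obj A).map_comp _ _)) }
  have : ∀ c, IsIso (η.app c) := fun c => by
    let e := Equiv.ofBijective _ (hα c)
    -- Inclusions into the iterated coproduct; reindexed along `e`, they assemble to the inverse of
    -- `η.app c`.
    let k : (Σ x : X.obj c, Y.obj (X.elementsMk c x)) →
        (A ⟶ (sumElementsObj X (Y ⋙ sigmaConst.obj A)).obj c) := fun p =>
      Limits.Sigma.ι (fun _ : Y.obj (X.elementsMk c p.1) => A) p.2 ≫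
        sumElementsι (Y ⋙ sigmaConst.obj A) c p.1
    have hk : ∀ p, k p ≫ η.app c = Limits.Sigma.ι (fun _ : W.obj c => A) (e p) := fun p => by
      rw [Category.assoc]
      erw [sumElementsι_desc]
      exact ι_sigmaConst_map _ _ _
    refine ⟨Limits.Sigma.desc fun w => k (e.symm w), ?_, ?_⟩
    · refine sumElements_hom_ext _ _ fun x => ?_
      refine Limits.Sigma.hom_ext _ _ fun y => ?_
      refine ((Category.assoc _ _ _).symm.trans (Category.assoc _ _ _).symm).trans ?_
      refine (congrArg (· ≫ _) (hk ⟨x, y⟩)).trans ?_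
      refine (Sigma.ι_desc _ _).trans ?_
      rw [e.symm_apply_apply]
      exact congrArg (_ ≫ ·) (Category.comp_id _).symm
    · refine Limits.Sigma.hom_ext _ _ fun w => ?_
      refine (Sigma.ι_desc_assoc _ _ _).trans ?_
      rw [hk, e.apply_symm_apply]
      exact (Category.comp_id _).symm
  have := NatIso.isIso_of_isIso_app η
  exact ⟨asIso η⟩

end FunctorCategory

/-! ### Free modules over the integers and dimension bounds for constant functors -/

section FreeModules

variable {C D : Type u} [SmallCategory C] [SmallCategory D]

/-- The integers, lifted to the universe `u`. -/
abbrev intModule : ModuleCat.{u} ℤ := ModuleCat.of ℤ (ULift.{u} ℤ)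

/-- The free functor to abelian groups on a functor to types. -/
noncomputable abbrev freeOn (X : C ⥤ Type u) : C ⥤ ModuleCat.{u} ℤ :=
  X ⋙ sigmaConst.obj intModule

lemma intModule_hom_ext {M : ModuleCat.{u} ℤ} {f g : intModule ⟶ M}
    (h : f (ULift.up 1) = g (ULift.up 1)) : f = g := by
  ext ⟨n⟩
  have hn : (ULift.up n : ULift.{u} ℤ) = n • ULift.up 1 := by ext; simp
  change f (ULift.up n) = g (ULift.up n)
  rw [hn, map_zsmul, map_zsmul, h]

/-- The morphism from the integers determined by an element. -/
def intModuleHom {M : ModuleCat.{u} ℤ} (x : M) : intModule ⟶ M :=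
  ModuleCat.ofHom ((LinearMap.toSpanSingleton ℤ M x).comp ULift.moduleEquiv.toLinearMap)

lemma intModuleHom_one {M : ModuleCat.{u} ℤ} (x : M) : intModuleHom x (ULift.up 1) = x :=
  LinearMap.toSpanSingleton_apply_one ℤ M x

instance : Projective intModule.{u} where
  factors f e _ := by
    obtain ⟨y, hy⟩ := (ModuleCat.epi_iff_surjective e).1 inferInstance (f (ULift.up 1))
    exact ⟨intModuleHom y, intModule_hom_ext 
      ((congrArg e (intModuleHom_one y)).trans hy)⟩

lemma isSeparator_intModule : IsSeparator intModule.{u} := fun M N f g h => by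
  ext x
  have := ConcreteCategory.congr_hom (h _ (by simp) (intModuleHom x)) (ULift.up 1)
  exact (congrArg f (intModuleHom_one x)).symm.trans
    (this.trans (congrArg g (intModuleHom_one x)))

instance : EnoughProjectives (C ⥤ ModuleCat.{u} ℤ) := ⟨fun M => by
  obtain ⟨J, f, p, hp⟩ := exists_epi_of_isSeparator intModule isSeparator_intModule M
  exact ⟨{ p := _, projective := projective_sigma _ fun j => projective_free _ (f j), f := p }⟩⟩

/-- The free functor on the terminal functor is constant. -/
noncomputable def freeOnPUnitIso :
    freeOn ((Functor.const C).obj PUnit.{u + 1}) ≅ (Functor.const C).obj intModule :=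
  NatIso.ofComponents (fun _ => coproductUniqueIso (fun _ : PUnit.{u + 1} => intModule))
    (fun _ => by
      refine Limits.Sigma.hom_ext _ _ fun x => ?_
      simp [coproductUniqueIso])

instance : AB4 (ModuleCat.{u} ℤ) where
  ofShape J :=
    HasExactColimitsOfShape.domain_of_functor (Discrete J)
      (forget₂ (ModuleCat.{u} ℤ) AddCommGrpCat.{u})

instance : AB4 (C ⥤ ModuleCat.{u} ℤ) := ⟨fun _ => inferInstance⟩

/-- An exact functor preserving coproducts raises the projective dimension by at most the
supremum of the projective dimensions of the images of the free modules of rank one. -/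
lemma hasProjectiveDimensionLT_map_of_free
    (S : (D ⥤ ModuleCat.{u} ℤ) ⥤ (C ⥤ ModuleCat.{u} ℤ)) [S.PreservesZeroMorphisms]
    [PreservesFiniteLimits S] [PreservesFiniteColimits S]
    [∀ J : Type u, PreservesColimitsOfShape (Discrete J) S] (m : ℕ)
    (hS : ∀ d : D, HasProjectiveDimensionLT
      (S.obj (freeOn (coyoneda.obj (Opposite.op d)))) (m + 1))
    (n : ℕ) (M : D ⥤ ModuleCat.{u} ℤ) (hM : HasProjectiveDimensionLT M (n + 1)) :
    HasProjectiveDimensionLT (S.obj M) (n + m + 1) :=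
  hasProjectiveDimensionLT_map S (fun d : D => freeOn (coyoneda.obj (Opposite.op d)))
    (fun d => projective_free _ d) (exists_epi_of_isSeparator _ isSeparator_intModule) m hS n M hM

/-- Restriction along `Φ` is exact, preserves coproducts and fixes constant functors. -/
lemma hasProjectiveDimensionLT_const_of_functor (Φ : C ⥤ D) (m : ℕ)
    (hΦ : ∀ d : D, HasProjectiveDimensionLT
      (freeOn (Φ ⋙ coyoneda.obj (Opposite.op d))) (m + 1))
    (n : ℕ) (hD : HasProjectiveDimensionLT ((Functor.const D).obj intModule.{u}) (n + 1)) :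
    HasProjectiveDimensionLT ((Functor.const C).obj intModule.{u}) (n + m + 1) :=
  hasProjectiveDimensionLT_map_of_free ((Functor.whiskeringLeft _ _ _).obj Φ) m hΦ n _ hD

/-- Restrict along `Φ`, then sum over the fibres of `X`. The composite sends the constant module to
`freeOn X`, and `hα` identifies the image of the free module at `d` with `freeOn (W d)`. -/
lemma hasProjectiveDimensionLT_freeOn_of_elements (X : C ⥤ Type u) (Φ : X.Elements ⥤ D)
    (W : D → C ⥤ Type u)
    (α : ∀ d, Φ ⋙ coyoneda.obj (Opposite.op d) ⟶ CategoryOfElements.π X ⋙ W d)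
    (hα : ∀ d c, Function.Bijective
      fun p : (Σ x : X.obj c, d ⟶ Φ.obj (X.elementsMk c x)) =>
        (α d).app (X.elementsMk c p.1) p.2)
    (m : ℕ) (hW : ∀ d, HasProjectiveDimensionLT (freeOn (W d)) (m + 1))
    (n : ℕ) (hD : HasProjectiveDimensionLT ((Functor.const D).obj intModule.{u}) (n + 1)) :
    HasProjectiveDimensionLT (freeOn X) (n + m + 1) := by
  have : PreservesFiniteLimits
      ((Functor.whiskeringLeft _ _ (ModuleCat.{u} ℤ)).obj Φ ⋙ sumElements X) :=
    have : PreservesFiniteLimits ((Functor.whiskeringLeft _ _ (ModuleCat.{u} ℤ)).obj Φ) :=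
      ⟨fun _ _ _ => inferInstance⟩
    comp_preservesFiniteLimits _ _
  have : PreservesFiniteColimits
      ((Functor.whiskeringLeft _ _ (ModuleCat.{u} ℤ)).obj Φ ⋙ sumElements X) :=
    have : PreservesFiniteColimits ((Functor.whiskeringLeft _ _ (ModuleCat.{u} ℤ)).obj Φ) :=
      ⟨fun _ _ _ => inferInstance⟩
    comp_preservesFiniteColimits _ _
  have h := hasProjectiveDimensionLT_map_of_free
    ((Functor.whiskeringLeft _ _ _).obj Φ ⋙ sumElements X) m
    (fun d => by
      obtain ⟨e⟩ := nonempty_sumElements_free_iso X intModule _ _ (α d) (hα d)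
      have := hW d
      exact hasProjectiveDimensionLT_of_iso e.symm _) n _ hD
  -- With one-point fibres, the sum of the constant functor is the free module on `X` itself.
  obtain ⟨e⟩ := nonempty_sumElements_free_iso X intModule
    ((Functor.const X.Elements).obj PUnit.{u + 1}) X
    { app e := ↾fun _ => e.2
      naturality e e' f := by ext; exact f.2.symm }
    (fun c => ⟨fun ⟨x, _⟩ ⟨y, _⟩ h => by obtain rfl : x = y := h; rfl, fun x => ⟨⟨x, ⟨⟩⟩, rfl⟩⟩)
  exact @hasProjectiveDimensionLT_of_iso _ _ _ _ _
    ((sumElements X).mapIso freeOnPUnitIso.symm ≪≫ e) _ h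

end FreeModules
end Bredon

namespace Bredon
open Limits

/-! ### Equivariant maps between orbits and induced functors -/

section Orbits

variable {G : Type u} [Group G]

/-- The `G`-map from `G ⧸ H` determined by an `H`-fixed point. -/
def ofFixed {H : Subgroup G} {T : Type*} [MulAction G T] (t : T) (ht : ∀ h ∈ H, h • t = t) :
    (G ⧸ H) →[G] T where
  toFun := Quotient.lift (fun g : G => g • t) fun a b hab => by
    have := ht _ (QuotientGroup.leftRel_apply.1 hab)
    rwa [mul_smul, inv_smul_eq_iff, eq_comm] at this
  map_smul' g x := by
    induction x using QuotientGroup.induction_on with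
    | H x => exact mul_smul g x t

lemma ofFixed_one {H : Subgroup G} {T : Type*} [MulAction G T] (t : T)
    (ht : ∀ h ∈ H, h • t = t) : ofFixed t ht ((1 : G) : G ⧸ H) = t := one_smul G t

lemma smul_mk_one {H : Subgroup G} (g : G) : g • ((1 : G) : G ⧸ H) = (g : G ⧸ H) :=
  congrArg _ (mul_one g)

lemma map_mk {H : Subgroup G} {T : Type*} [MulAction G T] (f : (G ⧸ H) →[G] T) (g : G) :
    f (g : G ⧸ H) = g • f ((1 : G) : G ⧸ H) := by
  rw [← smul_mk_one g, map_smul]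

lemma hom_ext_one {H : Subgroup G} {T : Type*} [MulAction G T] {f g : (G ⧸ H) →[G] T}
    (h : f ((1 : G) : G ⧸ H) = g ((1 : G) : G ⧸ H)) : f = g := by
  ext x
  induction x using QuotientGroup.induction_on with
  | H x => rw [map_mk f, map_mk g, h]

lemma map_one_fixed {H : Subgroup G} {T : Type*} [MulAction G T] (f : (G ⧸ H) →[G] T)
    (h : G) (hh : h ∈ H) : h • f ((1 : G) : G ⧸ H) = f ((1 : G) : G ⧸ H) := by
  rw [← map_mk f]
  congr 1
  exact QuotientGroup.eq.2 (by simpa using hh)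

/-- Lifting an equivariant map through an injective equivariant map. -/
noncomputable def liftHom {Z Y W : Type*} [MulAction G Z] [MulAction G Y] [MulAction G W]
    (b : Z →[G] Y) (hb : Function.Injective b) (v : W →[G] Y) (hv : ∀ w, ∃ z, b z = v w) :
    W →[G] Z where
  toFun w := (hv w).choose
  map_smul' g w := hb <| by
    rw [(hv (g • w)).choose_spec, map_smul, map_smul, (hv w).choose_spec]
    rfl

lemma apply_liftHom {Z Y W : Type*} [MulAction G Z] [MulAction G Y] [MulAction G W]
    (b : Z →[G] Y) (hb : Function.Injective b) (v : W →[G] Y) (hv : ∀ w, ∃ z, b z = v w) (w : W) :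
    b (liftHom b hb v hv w) = v w :=
  (hv w).choose_spec

/-- The projection `G ⧸ L → G' ⧸ φ(L)` induced by a group homomorphism. -/
def quotientMap {G' : Type u} [Group G'] (φ : G →* G') (L : Subgroup G) :
    G ⧸ L → G' ⧸ L.map φ :=
  Quotient.map' φ fun a b hab => by
    rw [QuotientGroup.leftRel_apply] at hab ⊢
    exact ⟨_, hab, by simp⟩

lemma quotientMap_smul {G' : Type u} [Group G'] (φ : G →* G') (L : Subgroup G) (g : G)
    (x : G ⧸ L) : quotientMap φ L (g • x) = φ g • quotientMap φ L x := by
  induction x using QuotientGroup.induction_on with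
  | H x => exact congrArg _ (map_mul φ g x)

/-- The `G`-map underlying a morphism of the orbit category. -/
def orbitHom {F : Set (Subgroup G)} {L L' : OrbitCat F} (f : L ⟶ L') :
    (G ⧸ L.subgroup) →[G] (G ⧸ L'.subgroup) := f

/-- The map `G' ⧸ φ(L) → G' ⧸ φ(L')` induced by a `G`-map `G ⧸ L → G ⧸ L'`. -/
def quotientMapHom {G' : Type u} [Group G'] (φ : G →* G') {L L' : Subgroup G}
    (f : (G ⧸ L) →[G] (G ⧸ L')) : (G' ⧸ L.map φ) →[G'] (G' ⧸ L'.map φ) :=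
  ofFixed (quotientMap φ L' (f ((1 : G) : G ⧸ L))) <| by
    rintro _ ⟨l, hl, rfl⟩
    rw [← quotientMap_smul, map_one_fixed _ l hl]

lemma quotientMapHom_quotientMap {G' : Type u} [Group G'] (φ : G →* G') {L L' : Subgroup G}
    (f : (G ⧸ L) →[G] (G ⧸ L')) (x : G ⧸ L) :
    quotientMapHom φ f (quotientMap φ L x) = quotientMap φ L' (f x) := by
  induction x using QuotientGroup.induction_on with
  | H x => rw [map_mk f, quotientMap_smul]; rfl

lemma quotientMap_one {G' : Type u} [Group G'] (φ : G →* G') (L : Subgroup G) :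
    quotientMap φ L ((1 : G) : G ⧸ L) = ((1 : G') : G' ⧸ L.map φ) :=
  congrArg _ (map_one φ)

/-- The functor of orbit categories `G ⧸ L ↦ G' ⧸ φ(L)` induced by a group homomorphism. -/
def orbitMap {G' : Type u} [Group G'] (φ : G →* G') {F : Set (Subgroup G)}
    {F' : Set (Subgroup G')} (h : ∀ L ∈ F, L.map φ ∈ F') : OrbitCat F ⥤ OrbitCat F' where
  obj L := ⟨L.subgroup.map φ, h _ L.mem⟩
  map f := quotientMapHom φ (orbitHom f)
  map_id L := hom_ext_one <| by
    rw [← quotientMap_one, quotientMapHom_quotientMap]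
    rfl
  map_comp {L L' L''} f g := hom_ext_one <| by
    rw [← quotientMap_one, quotientMapHom_quotientMap]
    exact ((congrArg (quotientMapHom φ (orbitHom g)) (quotientMapHom_quotientMap φ _ _)).trans
      (quotientMapHom_quotientMap φ _ _)).symm

/-- The functor of `G`-maps from orbits to a fixed `G`-set. -/
def homTo (F : Set (Subgroup G)) (T : Type u) [MulAction G T] : (OrbitCat F)ᵒᵖ ⥤ Type u where
  obj L := (G ⧸ L.unop.subgroup) →[G] T
  map f := ↾fun v => v.comp (orbitHom f.unop)

/-- The `G`-map underlying an element of `homTo F T`. -/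
def elementHom {F : Set (Subgroup G)} {T : Type u} [MulAction G T] (e : (homTo F T).Elements) :
    (G ⧸ e.1.unop.subgroup) →[G] T := e.2

end Orbits

/-! ### Orbits over a transitive set as orbits of the stabilizer -/

section Stabilizer

variable {G : Type u} [Group G] {K : Subgroup G}

/-- The `K`-map `K ⧸ J → G ⧸ L` with value `g⁻¹L` at the base point, where `J = K ∩ g⁻¹Lg`. -/
def fibreMap {J : Subgroup K} {L : Subgroup G} (g : G)
    (hJ : ∀ k : K, k ∈ J ↔ g * k * g⁻¹ ∈ L) : (K ⧸ J) →[K] (G ⧸ L) :=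
  ofFixed ((g⁻¹ : G) : G ⧸ L) fun k hk => by
    refine QuotientGroup.eq.2 ?_
    have := L.inv_mem ((hJ k).1 hk)
    simpa [mul_assoc] using this

lemma fibreMap_mk {J : Subgroup K} {L : Subgroup G} (g : G)
    (hJ : ∀ k : K, k ∈ J ↔ g * k * g⁻¹ ∈ L) (k : K) :
    fibreMap g hJ (k : K ⧸ J) = ((k * g⁻¹ : G) : G ⧸ L) := rfl

lemma fibreMap_one {J : Subgroup K} {L : Subgroup G} (g : G)
    (hJ : ∀ k : K, k ∈ J ↔ g * k * g⁻¹ ∈ L) :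
    fibreMap g hJ ((1 : K) : K ⧸ J) = ((g⁻¹ : G) : G ⧸ L) := ofFixed_one _ _

lemma fibreMap_injective {J : Subgroup K} {L : Subgroup G} (g : G)
    (hJ : ∀ k : K, k ∈ J ↔ g * k * g⁻¹ ∈ L) : Function.Injective (fibreMap g hJ) := by
  intro x y
  induction x using QuotientGroup.induction_on with
  | H x =>
  induction y using QuotientGroup.induction_on with
  | H y =>
    intro h
    rw [fibreMap_mk, fibreMap_mk, QuotientGroup.eq] at h
    refine QuotientGroup.eq.2 ((hJ _).2 ?_)
    simpa [mul_assoc] using h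

variable {T : Type u} [MulAction G T] {t₀ : T} (hK : ∀ g : G, g ∈ K ↔ g • t₀ = t₀)

-- Since f(yL) = y g t₀, the coset yL lies over t₀ exactly when y g ∈ K, and then yL = (y g) g⁻¹L is
-- the image of the coset of y g.
include hK in
lemma exists_fibreMap_eq_iff {J : Subgroup K} {L : Subgroup G} (g : G)
    (hJ : ∀ k : K, k ∈ J ↔ g * k * g⁻¹ ∈ L) (f : (G ⧸ L) →[G] T)
    (hf : f ((1 : G) : G ⧸ L) = g • t₀) (y : G ⧸ L) :
    (∃ z, fibreMap g hJ z = y) ↔ f y = t₀ := by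
  constructor
  · rintro ⟨z, rfl⟩
    induction z using QuotientGroup.induction_on with
    | H k =>
      rw [fibreMap_mk, map_mk f, hf, mul_smul, inv_smul_smul]
      exact (hK k).1 k.2
  · induction y using QuotientGroup.induction_on with
    | H y =>
      intro h
      rw [map_mk f, hf, ← mul_smul] at h
      refine ⟨((⟨y * g, (hK _).2 h⟩ : K) : K ⧸ J), ?_⟩
      rw [fibreMap_mk]
      simp

variable {𝓖 : Set (Subgroup G)} (h𝓖 : IsSubgroupClosedFamily 𝓖) (hT : ∀ t : T, ∃ g : G, g • t₀ = t)

/-- A group element translating the base point to the image of the base coset. -/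
noncomputable def translator (e : (homTo 𝓖 T).Elements) : G :=
  (hT (elementHom e ((1 : G) : G ⧸ e.1.unop.subgroup))).choose

lemma translator_spec (e : (homTo 𝓖 T).Elements) :
    elementHom e ((1 : G) : G ⧸ e.1.unop.subgroup) =
      translator hT e • t₀ :=
  (hT _).choose_spec.symm

variable (K) in
/-- The orbit of `K` isomorphic to the fibre over the base point. -/
noncomputable def fibreOrbit (e : (homTo 𝓖 T).Elements) : OrbitCat (restrictFamily 𝓖 K) where
  subgroup := (MulAut.conj (translator hT e)⁻¹ • e.1.unop.subgroup).subgroupOf K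
  mem := ⟨_, h𝓖.conj_mem _ _ e.1.unop.mem, rfl⟩

lemma mem_fibreOrbit (e : (homTo 𝓖 T).Elements) (k : K) :
    k ∈ (fibreOrbit K h𝓖 hT e).subgroup ↔
      translator hT e * k * (translator hT e)⁻¹ ∈ e.1.unop.subgroup := by
  change (k : G) ∈ MulAut.conj (translator hT e)⁻¹ • e.1.unop.subgroup ↔ _
  rw [Subgroup.mem_pointwise_smul_iff_inv_smul_mem]
  simp [← map_inv, MulAut.smul_def]

/-- The identification of an orbit of `K` with the fibre over the base point. -/
noncomputable def fibreOrbitMap (e : (homTo 𝓖 T).Elements) :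
    (K ⧸ (fibreOrbit K h𝓖 hT e).subgroup) →[K] (G ⧸ e.1.unop.subgroup) :=
  fibreMap (translator hT e) (mem_fibreOrbit h𝓖 hT e)

lemma translator_smul_fibreOrbitMap_one (e : (homTo 𝓖 T).Elements) :
    translator hT e • fibreOrbitMap (K := K) h𝓖 hT e ((1 : K) : K ⧸ _) =
      ((1 : G) : G ⧸ e.1.unop.subgroup) := by
  rw [← smul_inv_smul (translator hT e) ((1 : G) : G ⧸ e.1.unop.subgroup), smul_mk_one]
  exact congrArg (translator hT e • ·) (fibreMap_one _ (mem_fibreOrbit h𝓖 hT e))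

lemma fibreOrbitMap_injective (e : (homTo 𝓖 T).Elements) :
    Function.Injective (fibreOrbitMap (K := K) h𝓖 hT e) :=
  fibreMap_injective _ _

include hK in
lemma exists_fibreOrbitMap_eq_iff (e : (homTo 𝓖 T).Elements) (y : G ⧸ e.1.unop.subgroup) :
    (∃ z, fibreOrbitMap (K := K) h𝓖 hT e z = y) ↔
      elementHom e y = t₀ :=
  exists_fibreMap_eq_iff hK _ _ _ (translator_spec hT e) y

lemma elementHom_comp {e e' : (homTo 𝓖 T).Elements} (φ : e ⟶ e')
    (y : G ⧸ e'.1.unop.subgroup) :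
    elementHom e (orbitHom φ.val.unop y) = elementHom e' y :=
  congrArg (fun v : (G ⧸ e'.1.unop.subgroup) →[G] T => v y) φ.2

/-- The map between orbits of `K` induced by a morphism of the category of elements. -/
noncomputable def fibreOrbitHom {e e' : (homTo 𝓖 T).Elements} (φ : e ⟶ e') :
    (K ⧸ (fibreOrbit K h𝓖 hT e').subgroup) →[K] (K ⧸ (fibreOrbit K h𝓖 hT e).subgroup) :=
  liftHom (fibreOrbitMap h𝓖 hT e) (fibreOrbitMap_injective h𝓖 hT e)
    { toFun z := orbitHom φ.val.unop (fibreOrbitMap h𝓖 hT e' z)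
      map_smul' k z := by
        rw [map_smul]
        exact map_smul (orbitHom φ.val.unop) (k : G) _ }
    fun z => (exists_fibreOrbitMap_eq_iff hK h𝓖 hT e _).2 <|
      (elementHom_comp φ _).trans ((exists_fibreOrbitMap_eq_iff hK h𝓖 hT e' _).1 ⟨z, rfl⟩)

lemma fibreOrbitMap_fibreOrbitHom {e e' : (homTo 𝓖 T).Elements} (φ : e ⟶ e')
    (z : K ⧸ (fibreOrbit K h𝓖 hT e').subgroup) :
    fibreOrbitMap h𝓖 hT e (fibreOrbitHom hK h𝓖 hT φ z) =
      orbitHom φ.val.unop (fibreOrbitMap h𝓖 hT e' z) :=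
  apply_liftHom _ _ _ _ z

/-- The functor sending `f : G ⧸ L → T` to the orbit of `K` identified with the fibre of `f` over
the base point. -/
noncomputable def fibreFunctor : (homTo 𝓖 T).Elements ⥤ (OrbitCat (restrictFamily 𝓖 K))ᵒᵖ where
  obj e := Opposite.op (fibreOrbit K h𝓖 hT e)
  map φ := Quiver.Hom.op (X := fibreOrbit K h𝓖 hT _) (Y := fibreOrbit K h𝓖 hT _)
    (fibreOrbitHom hK h𝓖 hT φ)
  -- The functor laws are checked after the injection into G/L, where the induced maps become
  -- restrictions of the original G-maps.
  map_id e := Quiver.Hom.unop_inj <| MulActionHom.ext fun z =>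
    fibreOrbitMap_injective h𝓖 hT e (fibreOrbitMap_fibreOrbitHom hK h𝓖 hT (𝟙 e) z)
  map_comp {e _ _} φ ψ := Quiver.Hom.unop_inj <| MulActionHom.ext fun z =>
    fibreOrbitMap_injective h𝓖 hT e <|
      (fibreOrbitMap_fibreOrbitHom hK h𝓖 hT (φ ≫ ψ) z).trans <| Eq.symm <|
        (fibreOrbitMap_fibreOrbitHom hK h𝓖 hT φ (fibreOrbitHom hK h𝓖 hT ψ z)).trans <|
          congrArg (orbitHom φ.val.unop) (fibreOrbitMap_fibreOrbitHom hK h𝓖 hT ψ z)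

-- Uses subgroup-closure: J has the form H ∩ K with H in the family, although K need not belong to
-- it.
include h𝓖 in
lemma map_subtype_mem (J : OrbitCat (restrictFamily 𝓖 K)) : J.subgroup.map K.subtype ∈ 𝓖 := by
  obtain ⟨H, hH, hJ⟩ := J.mem
  refine h𝓖.mem_of_le H hH _ ?_
  rw [hJ, Subgroup.subgroupOf_map_subtype]
  exact inf_le_left

lemma mem_iff_mem_map_subtype (J : Subgroup K) (k : K) :
    k ∈ J ↔ (1 : G) * k * 1⁻¹ ∈ J.map K.subtype := by
  simp

/-- The `K`-map from `K ⧸ J` to `G ⧸ J`. -/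
def inclOrbit (J : Subgroup K) : (K ⧸ J) →[K] (G ⧸ J.map K.subtype) :=
  fibreMap 1 (mem_iff_mem_map_subtype J)

/-- Extension of a `K`-map on the fibre over the base point to a `G`-map. -/
noncomputable def extendHom (e : (homTo 𝓖 T).Elements) {J : Subgroup K}
    (v : (K ⧸ (fibreOrbit K h𝓖 hT e).subgroup) →[K] (K ⧸ J)) :
    (G ⧸ e.1.unop.subgroup) →[G] (G ⧸ J.map K.subtype) :=
  ofFixed (translator hT e • inclOrbit J (v ((1 : K) : K ⧸ _))) fun l hl => by
    -- As l fixes the base coset, it fixes the image g t₀ of that coset, so g⁻¹ l g stabilizes t₀;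
    -- it also lies in the stabilizer K ∩ g⁻¹Lg, hence fixes the value of v.
    have hk : (translator hT e)⁻¹ * l * translator hT e ∈ K := by
      rw [hK, mul_smul, mul_smul, inv_smul_eq_iff, ← translator_spec hT e]
      exact map_one_fixed (elementHom e) l hl
    have h := map_one_fixed v ⟨_, hk⟩ ((mem_fibreOrbit h𝓖 hT e _).2 (by simpa [mul_assoc] using hl))
    have h' := congrArg (inclOrbit J) h
    rw [map_smul] at h'
    generalize inclOrbit J _ = w at h' ⊢
    calc l • translator hT e • w
        = translator hT e • ((translator hT e)⁻¹ * l * translator hT e) • w := by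
          rw [← mul_smul, ← mul_smul]
          group
      _ = translator hT e • w := congrArg (translator hT e • ·) h'

lemma extendHom_fibreOrbitMap (e : (homTo 𝓖 T).Elements) {J : Subgroup K}
    (v : (K ⧸ (fibreOrbit K h𝓖 hT e).subgroup) →[K] (K ⧸ J))
    (z : K ⧸ (fibreOrbit K h𝓖 hT e).subgroup) :
    extendHom hK h𝓖 hT e v (fibreOrbitMap h𝓖 hT e z) = inclOrbit J (v z) := by
  induction z using QuotientGroup.induction_on with
  | H k =>
    rw [map_mk v, map_smul]
    change extendHom hK h𝓖 hT e v ((k * (translator hT e)⁻¹ : G) : G ⧸ _) = (k : G) • _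
    rw [map_mk, mul_smul]
    congr 1
    rw [inv_smul_eq_iff]
    exact ofFixed_one _ _

end Stabilizer
end Bredon

namespace Bredon
open Limits

/-! ### Induction from the stabilizer and the dimension of ℤ[T] -/

section Stabilizer

variable {G : Type u} [Group G] {K : Subgroup G}
variable {T : Type u} [MulAction G T] {t₀ : T} (hK : ∀ g : G, g ∈ K ↔ g • t₀ = t₀)

/-- The `G`-map `G ⧸ J → T` with value `t₀` at the base point. -/
def orbitToBase (J : Subgroup K) : (G ⧸ J.map K.subtype) →[G] T :=
  ofFixed t₀ <| by
    rintro _ ⟨k, -, rfl⟩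
    exact (hK k).1 k.2

lemma exists_inclOrbit_eq_iff (J : Subgroup K) (y : G ⧸ J.map K.subtype) :
    (∃ z, inclOrbit J z = y) ↔ orbitToBase hK J y = t₀ :=
  exists_fibreMap_eq_iff hK _ _ _ rfl y

variable {𝓖 : Set (Subgroup G)} (h𝓖 : IsSubgroupClosedFamily 𝓖) (hT : ∀ t : T, ∃ g : G, g • t₀ = t)

lemma orbitToBase_extendHom (e : (homTo 𝓖 T).Elements) {J : Subgroup K}
    (v : (K ⧸ (fibreOrbit K h𝓖 hT e).subgroup) →[K] (K ⧸ J)) :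
    (orbitToBase hK J).comp (extendHom hK h𝓖 hT e v) = elementHom e :=
  hom_ext_one <| by
    rw [translator_spec hT e]
    refine (congrArg (orbitToBase hK J) (ofFixed_one _ _)).trans ?_
    rw [map_smul, (exists_inclOrbit_eq_iff hK J _).1 ⟨_, rfl⟩]

lemma extendHom_comp {e e' : (homTo 𝓖 T).Elements} (φ : e ⟶ e') {J : Subgroup K}
    (v : (K ⧸ (fibreOrbit K h𝓖 hT e).subgroup) →[K] (K ⧸ J)) :
    extendHom hK h𝓖 hT e' (v.comp (fibreOrbitHom hK h𝓖 hT φ)) =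
      (extendHom hK h𝓖 hT e v).comp (orbitHom φ.val.unop) :=
  hom_ext_one <| by
    refine (ofFixed_one _ _).trans ?_
    rw [MulActionHom.comp_apply, ← extendHom_fibreOrbitMap hK h𝓖 hT, fibreOrbitMap_fibreOrbitHom,
      MulActionHom.comp_apply, ← map_smul, ← map_smul, translator_smul_fibreOrbitMap_one]

lemma extendHom_injective (e : (homTo 𝓖 T).Elements) (J : Subgroup K) :
    Function.Injective (extendHom hK h𝓖 hT e (J := J)) := fun v v' h =>
  MulActionHom.ext fun z => fibreMap_injective _ (mem_iff_mem_map_subtype J) <|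
    (extendHom_fibreOrbitMap hK h𝓖 hT e v z).symm.trans <|
      (DFunLike.congr_fun h _).trans (extendHom_fibreOrbitMap hK h𝓖 hT e v' z)

/-- A G-map over T carries the fibre over t₀ to the fibre over t₀; the latter is K/J, so the
restriction is the required K-map. -/
lemma exists_extendHom_eq (e : (homTo 𝓖 T).Elements) (J : Subgroup K)
    (w : (G ⧸ e.1.unop.subgroup) →[G] (G ⧸ J.map K.subtype))
    (hw : (orbitToBase hK J).comp w = elementHom e) : ∃ v, extendHom hK h𝓖 hT e v = w := by
  let v : (K ⧸ (fibreOrbit K h𝓖 hT e).subgroup) →[K] (K ⧸ J) :=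
    liftHom (inclOrbit J) (fibreMap_injective _ _)
      { toFun z := w (fibreOrbitMap h𝓖 hT e z)
        map_smul' k z := by
          rw [map_smul]
          exact map_smul w (k : G) _ }
      fun z => (exists_inclOrbit_eq_iff hK J _).2 <|
        (DFunLike.congr_fun hw _).trans ((exists_fibreOrbitMap_eq_iff hK h𝓖 hT e _).1 ⟨z, rfl⟩)
  refine ⟨v, hom_ext_one ?_⟩
  rw [← translator_smul_fibreOrbitMap_one (K := K) h𝓖 hT e, map_smul, map_smul,
    extendHom_fibreOrbitMap]
  exact congrArg (translator hT e • ·) (apply_liftHom (inclOrbit J) _ _ _ _)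

/-- Extension of `K`-maps to `G`-maps as a natural transformation. -/
noncomputable def extendNatTrans (J : OrbitCat (restrictFamily 𝓖 K)) :
    fibreFunctor hK h𝓖 hT ⋙ coyoneda.obj (Opposite.op (Opposite.op J)) ⟶
      CategoryOfElements.π (homTo 𝓖 T) ⋙ coyoneda.obj (Opposite.op (Opposite.op
        (⟨J.subgroup.map K.subtype, map_subtype_mem h𝓖 J⟩ : OrbitCat 𝓖))) where
  app e := ↾fun v => Quiver.Hom.op (X := e.1.unop) (Y := ⟨_, map_subtype_mem h𝓖 J⟩)
    (extendHom hK h𝓖 hT e (orbitHom v.unop))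
  naturality e e' φ := by
    ext v
    exact Quiver.Hom.unop_inj (extendHom_comp hK h𝓖 hT φ (orbitHom v.unop))

/-- A G-map w : G/L → G/J determines its structure map to T, by composing with G/J → T, and its
restriction to fibres over t₀; conversely these two data recover w. -/
lemma extendNatTrans_bijective (J : OrbitCat (restrictFamily 𝓖 K)) (c : (OrbitCat 𝓖)ᵒᵖ) :
    Function.Bijective (β := Opposite.op (⟨_, map_subtype_mem h𝓖 J⟩ : OrbitCat 𝓖) ⟶ c)
      fun p : (Σ x : (homTo 𝓖 T).obj c, Opposite.op J ⟶
        (fibreFunctor hK h𝓖 hT).obj (Functor.elementsMk _ c x)) =>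
          (extendNatTrans hK h𝓖 hT J).app (Functor.elementsMk _ c p.1) p.2 := by
  constructor
  · rintro ⟨x, v⟩ ⟨x', v'⟩ h
    let e := (homTo 𝓖 T).elementsMk c x
    let e' := (homTo 𝓖 T).elementsMk c x'
    let u : (K ⧸ (fibreOrbit K h𝓖 hT e).subgroup) →[K] (K ⧸ J.subgroup) := orbitHom v.unop
    let u' : (K ⧸ (fibreOrbit K h𝓖 hT e').subgroup) →[K] (K ⧸ J.subgroup) := orbitHom v'.unop
    have h' : extendHom hK h𝓖 hT e u = extendHom hK h𝓖 hT e' u' := congrArg Quiver.Hom.unop h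
    have h₁ : x = (orbitToBase hK J.subgroup).comp (extendHom hK h𝓖 hT e u) :=
      (orbitToBase_extendHom hK h𝓖 hT e u).symm
    have h₂ : x' = (orbitToBase hK J.subgroup).comp (extendHom hK h𝓖 hT e' u') :=
      (orbitToBase_extendHom hK h𝓖 hT e' u').symm
    have hx : x = x' := h₁.trans ((congrArg (fun w : (G ⧸ c.unop.subgroup) →[G]
      (G ⧸ J.subgroup.map K.subtype) => (orbitToBase hK J.subgroup).comp w) h').trans h₂.symm)
    clear h₁ h₂
    subst hx
    have hu : u = u' := extendHom_injective hK h𝓖 hT e _ h'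
    exact congrArg (Sigma.mk x) (Quiver.Hom.unop_inj hu)
  · intro w
    let w' : (G ⧸ c.unop.subgroup) →[G] (G ⧸ J.subgroup.map K.subtype) :=
      orbitHom (L := c.unop) (L' := ⟨_, map_subtype_mem h𝓖 J⟩) w.unop
    let e := (homTo 𝓖 T).elementsMk c ((orbitToBase hK J.subgroup).comp w')
    obtain ⟨v, hv⟩ := exists_extendHom_eq hK h𝓖 hT e J.subgroup w' rfl
    exact ⟨⟨_, Quiver.Hom.op (X := fibreOrbit K h𝓖 hT e) (Y := J) v⟩, Quiver.Hom.unop_inj hv⟩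

include hK h𝓖 hT in
/-- The free module on the maps to a transitive `G`-set has projective dimension at most the
Bredon cohomological dimension of the stabilizer. -/
lemma hasProjectiveDimensionLT_freeOn_homTo (k : ℕ)
    (hk : HasProjectiveDimensionLT (trivialModule (restrictFamily 𝓖 K)) (k + 1)) :
    HasProjectiveDimensionLT (freeOn (homTo 𝓖 T)) (k + 1) :=
  -- The increment is 0 because ℤ[K/J] goes to the projective ℤ[G/J].
  hasProjectiveDimensionLT_freeOn_of_elements (homTo 𝓖 T) (fibreFunctor hK h𝓖 hT) _
    (fun d => extendNatTrans hK h𝓖 hT d.unop)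
    (fun _ _ => extendNatTrans_bijective hK h𝓖 hT _ _) 0
    (fun _ => projective_iff_hasProjectiveDimensionLT_one.1 (projective_free intModule _)) k hk

end Stabilizer

/-! ### Maps into products of orbits -/

section Product

variable {G₁ G₂ : Type u} [Group G₁] [Group G₂]

/-- The product of a `G₁`-set and a `G₂`-set, as a `G₁ × G₂`-set. -/
def ProdSet (T₁ T₂ : Type u) : Type u := T₁ × T₂

instance (T₁ T₂ : Type u) [MulAction G₁ T₁] [MulAction G₂ T₂] :
    MulAction (G₁ × G₂) (ProdSet T₁ T₂) where
  smul g t := (g.1 • t.1, g.2 • t.2)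
  one_smul _ := Prod.ext (one_smul _ _) (one_smul _ _)
  mul_smul _ _ _ := Prod.ext (mul_smul _ _ _) (mul_smul _ _ _)

/-- The equivariant map `(G₁ × G₂) ⧸ L → T₁ × T₂` with given components. -/
def pairHom {T₁ T₂ : Type u} [MulAction G₁ T₁] [MulAction G₂ T₂] {L : Subgroup (G₁ × G₂)}
    (f₁ : (G₁ ⧸ L.map (MonoidHom.fst G₁ G₂)) →[G₁] T₁)
    (f₂ : (G₂ ⧸ L.map (MonoidHom.snd G₁ G₂)) →[G₂] T₂) :
    ((G₁ × G₂) ⧸ L) →[G₁ × G₂] ProdSet T₁ T₂ where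
  toFun x := (f₁ (quotientMap (MonoidHom.fst G₁ G₂) L x), f₂ (quotientMap (MonoidHom.snd G₁ G₂) L x))
  map_smul' g x := by
    rw [quotientMap_smul, quotientMap_smul, map_smul, map_smul]
    rfl

lemma pairHom_comp {T₁ T₂ : Type u} [MulAction G₁ T₁] [MulAction G₂ T₂]
    {L L' : Subgroup (G₁ × G₂)} (h : ((G₁ × G₂) ⧸ L') →[G₁ × G₂] ((G₁ × G₂) ⧸ L))
    (f₁ : (G₁ ⧸ L.map (MonoidHom.fst G₁ G₂)) →[G₁] T₁)
    (f₂ : (G₂ ⧸ L.map (MonoidHom.snd G₁ G₂)) →[G₂] T₂) :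
    pairHom (f₁.comp (quotientMapHom _ h)) (f₂.comp (quotientMapHom _ h)) =
      (pairHom f₁ f₂).comp h :=
  MulActionHom.ext fun x => Prod.ext (congrArg f₁ (quotientMapHom_quotientMap _ h x))
    (congrArg f₂ (quotientMapHom_quotientMap _ h x))

/-- Equivariant maps from orbits are fixed points of the target, and L fixes (t₁, t₂) exactly when
each projection of L fixes the corresponding tᵢ. -/
lemma pairHom_bijective {T₁ T₂ : Type u} [MulAction G₁ T₁] [MulAction G₂ T₂]
    (L : Subgroup (G₁ × G₂)) :
    Function.Bijective fun p : (Σ _ : (G₁ ⧸ L.map (MonoidHom.fst G₁ G₂)) →[G₁] T₁,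
      (G₂ ⧸ L.map (MonoidHom.snd G₁ G₂)) →[G₂] T₂) => pairHom p.1 p.2 := by
  constructor
  · rintro ⟨f₁, f₂⟩ ⟨f₁', f₂'⟩ h
    replace h : pairHom f₁ f₂ = pairHom f₁' f₂' := h
    have h' := DFunLike.congr_fun h ((1 : G₁ × G₂) : (G₁ × G₂) ⧸ L)
    obtain rfl : f₁ = f₁' := hom_ext_one (congrArg Prod.fst h')
    obtain rfl : f₂ = f₂' := hom_ext_one (congrArg Prod.snd h')
    rfl
  · intro f
    refine ⟨⟨ofFixed (f ((1 : G₁ × G₂) : (G₁ × G₂) ⧸ L)).1 ?_,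
      ofFixed (f ((1 : G₁ × G₂) : (G₁ × G₂) ⧸ L)).2 ?_⟩, hom_ext_one ?_⟩
    · rintro _ ⟨l, hl, rfl⟩
      exact congrArg Prod.fst (map_one_fixed f l hl)
    · rintro _ ⟨l, hl, rfl⟩
      exact congrArg Prod.snd (map_one_fixed f l hl)
    · exact Prod.ext (one_smul _ _) (one_smul _ _)

variable {F₁ : Set (Subgroup G₁)} {F₂ : Set (Subgroup G₂)} {𝓖 : Set (Subgroup (G₁ × G₂))}
  (h₁ : ∀ L ∈ 𝓖, L.map (MonoidHom.fst G₁ G₂) ∈ F₁) (h₂ : ∀ L ∈ 𝓖, L.map (MonoidHom.snd G₁ G₂) ∈ F₂)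

/-- The functor of `G₁`-maps from the projections of orbits to a fixed `G₁`-set. -/
abbrev fstHomTo (T₁ : Type u) [MulAction G₁ T₁] : (OrbitCat 𝓖)ᵒᵖ ⥤ Type u :=
  (orbitMap (MonoidHom.fst G₁ G₂) h₁).op ⋙ homTo F₁ T₁

/-- The maps to a product of orbits are the pairs of maps to the factors. -/
def pairNatTrans (T₁ : Type u) [MulAction G₁ T₁] (d₂ : (OrbitCat F₂)ᵒᵖ) :
    (CategoryOfElements.π (fstHomTo h₁ T₁) ⋙ (orbitMap (MonoidHom.snd G₁ G₂) h₂).op) ⋙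
        coyoneda.obj (Opposite.op d₂) ⟶
      CategoryOfElements.π (fstHomTo h₁ T₁) ⋙
        homTo 𝓖 (ProdSet T₁ (G₂ ⧸ d₂.unop.subgroup)) where
  app e := ↾fun v => pairHom (L := e.1.unop.subgroup) e.2
    (orbitHom (L := (orbitMap (MonoidHom.snd G₁ G₂) h₂).obj e.1.unop) (L' := d₂.unop) v.unop)
  naturality e e' φ := by
    ext v
    exact (congrArg (fun f => pairHom (L := e'.1.unop.subgroup) f _) φ.2.symm).trans
      (pairHom_comp (orbitHom φ.val.unop) e.2
        (orbitHom (L := (orbitMap (MonoidHom.snd G₁ G₂) h₂).obj e.1.unop) (L' := d₂.unop) v.unop))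

end Product

/-- The corepresentable functors are the functors of maps to an orbit. -/
def coyonedaIsoHomTo {G : Type u} [Group G] {F : Set (Subgroup G)} (d : (OrbitCat F)ᵒᵖ) :
    coyoneda.obj (Opposite.op d) ≅ homTo F (G ⧸ d.unop.subgroup) :=
  NatIso.ofComponents (fun L => Equiv.toIso (opEquiv d L))

/-- The Bredon cohomological dimension of a non-empty family is not `⊥`. -/
lemma cd_ne_bot {G : Type u} [Group G] {F : Set (Subgroup G)} (hF : F.Nonempty) : cd F ≠ ⊥ := by
  obtain ⟨H, hH⟩ := hF
  intro h
  have h₀ := (projectiveDimension_eq_bot_iff _).1 h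
  have h₁ : IsZero (intModule.{u}) := h₀.obj (Opposite.op ⟨H, hH⟩)
  have := ModuleCat.subsingleton_of_isZero h₁
  exact zero_ne_one (congrArg ULift.down (Subsingleton.elim (ULift.up 0 : ULift.{u} ℤ) (ULift.up 1)))

lemma exists_cd_eq {G : Type u} [Group G] {F : Set (Subgroup G)} (hF : F.Nonempty)
    (h : cd F ≠ ⊤) : ∃ n : ℕ, cd F = n := by
  have h' := cd_ne_bot hF
  generalize cd F = x at *
  induction x with
  | bot => exact absurd rfl h'
  | coe x =>
    induction x with
    | top => exact absurd rfl h
    | coe n => exact ⟨n, rfl⟩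

lemma top_add_of_ne_bot {x : WithBot ℕ∞} (hx : x ≠ ⊥) : ⊤ + x = ⊤ := by
  induction x with
  | bot => exact absurd rfl hx
  | coe x => exact congrArg WithBot.some (top_add x)

/-! ### Assembling the bound -/

section Main

variable {G₁ G₂ : Type u} [Group G₁] [Group G₂] {F₁ : Set (Subgroup G₁)} {F₂ : Set (Subgroup G₂)}
  {𝓖 : Set (Subgroup (G₁ × G₂))}

/-- Containment in the completion makes the projection functor to the orbit category of G₁ well
defined. -/
lemma map_fst_mem (hF₁ : IsSubgroupClosedFamily F₁)
    (h𝓖F : 𝓖 ⊆ subgroupCompletion (prodFamily F₁ F₂)) (L : Subgroup (G₁ × G₂)) (hL : L ∈ 𝓖) :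
    L.map (MonoidHom.fst G₁ G₂) ∈ F₁ := by
  obtain ⟨_, ⟨H₁, hH₁, H₂, -, rfl⟩, hLH⟩ := h𝓖F hL
  exact hF₁.mem_of_le H₁ hH₁ _ (Subgroup.map_le_iff_le_comap.2 fun x hx => (hLH hx).1)

lemma map_snd_mem (hF₂ : IsSubgroupClosedFamily F₂)
    (h𝓖F : 𝓖 ⊆ subgroupCompletion (prodFamily F₁ F₂)) (L : Subgroup (G₁ × G₂)) (hL : L ∈ 𝓖) :
    L.map (MonoidHom.snd G₁ G₂) ∈ F₂ := by
  obtain ⟨_, ⟨H₁, -, H₂, hH₂, rfl⟩, hLH⟩ := h𝓖F hL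
  exact hF₂.mem_of_le H₂ hH₂ _ (Subgroup.map_le_iff_le_comap.2 fun x hx => (hLH hx).2)

/-- The base point of a product of orbits. -/
def prodBase (H₁ : Subgroup G₁) (H₂ : Subgroup G₂) : ProdSet (G₁ ⧸ H₁) (G₂ ⧸ H₂) :=
  (((1 : G₁) : G₁ ⧸ H₁), ((1 : G₂) : G₂ ⧸ H₂))

/-- The point stabilizer in a product of orbits. -/
lemma mem_prod_iff_smul_eq (H₁ : Subgroup G₁) (H₂ : Subgroup G₂) (g : G₁ × G₂) :
    g ∈ H₁.prod H₂ ↔ g • prodBase H₁ H₂ = prodBase H₁ H₂ := by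
  refine Iff.trans ?_ (Prod.ext_iff (α := G₁ ⧸ H₁) (β := G₂ ⧸ H₂)).symm
  change _ ↔ g.1 • ((1 : G₁) : G₁ ⧸ H₁) = ((1 : G₁) : G₁ ⧸ H₁) ∧
    g.2 • ((1 : G₂) : G₂ ⧸ H₂) = ((1 : G₂) : G₂ ⧸ H₂)
  rw [smul_mk_one, smul_mk_one, QuotientGroup.eq, QuotientGroup.eq, Subgroup.mem_prod]
  simp

lemma exists_smul_eq_prod (H₁ : Subgroup G₁) (H₂ : Subgroup G₂)
    (t : ProdSet (G₁ ⧸ H₁) (G₂ ⧸ H₂)) : ∃ g : G₁ × G₂, g • prodBase H₁ H₂ = t := by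
  obtain ⟨t₁, t₂⟩ := t
  obtain ⟨g₁, rfl⟩ := QuotientGroup.mk_surjective t₁
  obtain ⟨g₂, rfl⟩ := QuotientGroup.mk_surjective t₂
  exact ⟨(g₁, g₂), Prod.ext (α := G₁ ⧸ H₁) (β := G₂ ⧸ H₂) (smul_mk_one g₁) (smul_mk_one g₂)⟩

lemma hasProjectiveDimensionLT_trivialModule_prod (hF₁ : IsSubgroupClosedFamily F₁)
    (hF₂ : IsSubgroupClosedFamily F₂) (h𝓖 : IsSubgroupClosedFamily 𝓖)
    (h𝓖F : 𝓖 ⊆ subgroupCompletion (prodFamily F₁ F₂)) (k : ℕ)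
    (hk : ∀ K ∈ prodFamily F₁ F₂,
      HasProjectiveDimensionLT (trivialModule (restrictFamily 𝓖 K)) (k + 1)) (n₁ n₂ : ℕ)
    (hn₁ : HasProjectiveDimensionLT (trivialModule F₁) (n₁ + 1))
    (hn₂ : HasProjectiveDimensionLT (trivialModule F₂) (n₂ + 1)) :
    HasProjectiveDimensionLT (trivialModule 𝓖) (n₁ + (n₂ + k) + 1) := by
  have h₁ := map_fst_mem hF₁ h𝓖F
  have h₂ := map_snd_mem hF₂ h𝓖F
  refine hasProjectiveDimensionLT_const_of_functor (orbitMap _ h₁).op (n₂ + k) (fun d₁ => ?_) n₁ hn₁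
  have : HasProjectiveDimensionLT (freeOn (fstHomTo h₁ (G₁ ⧸ d₁.unop.subgroup))) (n₂ + k + 1) :=
    hasProjectiveDimensionLT_freeOn_of_elements _ _ _
      (fun d₂ => pairNatTrans h₁ h₂ (G₁ ⧸ d₁.unop.subgroup) d₂)
      (fun d₂ c => by
        -- Only passes from morphisms in the opposite orbit category to G₂-maps, where
        -- `pairHom_bijective` applies.
        have e := (Equiv.sigmaCongrRight fun _ : (G₁ ⧸ c.unop.subgroup.map (MonoidHom.fst G₁ G₂))
          →[G₁] (G₁ ⧸ d₁.unop.subgroup) => 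
            opEquiv d₂ ((orbitMap (MonoidHom.snd G₁ G₂) h₂).op.obj c)).bijective
        exact (pairHom_bijective c.unop.subgroup).comp e) k
      (fun d₂ => hasProjectiveDimensionLT_freeOn_homTo
        (mem_prod_iff_smul_eq d₁.unop.subgroup d₂.unop.subgroup) h𝓖
        (exists_smul_eq_prod d₁.unop.subgroup d₂.unop.subgroup) k
        (hk _ ⟨_, d₁.unop.mem, _, d₂.unop.mem, rfl⟩)) n₂ hn₂
  exact hasProjectiveDimensionLT_of_iso (Functor.isoWhiskerRight
    (Functor.isoWhiskerLeft (orbitMap _ h₁).op (coyonedaIsoHomTo d₁).symm) _) _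

end Main
end Bredon

theorem mainTheorem7 {G₁ G₂ : Type u} [Group G₁] [Group G₂]
    (F₁ : Set (Subgroup G₁)) (F₂ : Set (Subgroup G₂))
    (hF₁ : Bredon.IsSubgroupClosedFamily F₁) (hF₂ : Bredon.IsSubgroupClosedFamily F₂)
    (𝓖 : Set (Subgroup (G₁ × G₂))) (h𝓖 : Bredon.IsSubgroupClosedFamily 𝓖)
    (h𝓖F : 𝓖 ⊆ Bredon.subgroupCompletion (Bredon.prodFamily F₁ F₂))
    (k : ℕ)
    (hk : ∀ K ∈ Bredon.prodFamily F₁ F₂, Bredon.cd (Bredon.restrictFamily 𝓖 K) ≤ (k : WithBot ℕ∞)) :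
    Bredon.cd 𝓖 ≤ Bredon.cd F₁ + Bredon.cd F₂ + (k : WithBot ℕ∞) := by
  have hk' : ((k : ℕ) : WithBot ℕ∞) ≠ ⊥ := WithBot.coe_ne_bot
  have hb₁ := Bredon.cd_ne_bot hF₁.nonempty
  have hb₂ := Bredon.cd_ne_bot hF₂.nonempty
  -- In `WithBot ℕ∞` the sum ⊤ + ⊥ is ⊥, so the infinite cases need the other summands to differ
  -- from ⊥.
  by_cases ht₁ : Bredon.cd F₁ = ⊤
  · rw [ht₁, Bredon.top_add_of_ne_bot hb₂, Bredon.top_add_of_ne_bot hk']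
    exact le_top
  by_cases ht₂ : Bredon.cd F₂ = ⊤
  · rw [ht₂, add_comm (Bredon.cd F₁), Bredon.top_add_of_ne_bot hb₁, Bredon.top_add_of_ne_bot hk']
    exact le_top
  obtain ⟨n₁, hn₁⟩ := Bredon.exists_cd_eq hF₁.nonempty ht₁
  obtain ⟨n₂, hn₂⟩ := Bredon.exists_cd_eq hF₂.nonempty ht₂
  have := (projectiveDimension_le_iff _ _).2 <|
    Bredon.hasProjectiveDimensionLT_trivialModule_prod hF₁ hF₂ h𝓖 h𝓖F k
      (fun K hK => (projectiveDimension_le_iff _ k).1 (hk K hK)) n₁ n₂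
      ((projectiveDimension_le_iff _ _).1 hn₁.le) ((projectiveDimension_le_iff _ _).1 hn₂.le)
  rw [hn₁, hn₂, add_assoc]
  exact_mod_cast this
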